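/- Let $G=(V,E)$ be a finite simple connected graph with at least two vertices that is bipartite and planar, and let $$\mathcal P_G=\mathrm{conv}\{\mathbf e_v-\mathbf e_w,\ \mathbf e_w-\mathbf e_v : \{v,w\}\in E\}\subset\mathbb R^V$$ be its symmetric edge polytope. Fix any planar embedding of $G$, given combinatorially by the cyclic orders of the edges around the vertices (a rotation system whose surface is the sphere, i.e. $|V|-|E|+|\{\text{faces}\}|=2$), and let $G^*$ be the corresponding planar dual: the multigraph (loops and parallel edges allowed) whose vertices are the faces of the embedding, and which has for every $e\in E$ one edge $e^*$ joining the faces on the two sides of $e$. Choose arbitrarily a tail $t(e^*)$ and a head $h(e^*)$ for every edge $e^*$ of $G^*$. A nowhere-zero $2$-flow on $G^*$ is a map $x\colon E(G^*)\to\mathbb Z$ with $x\ne 0$ and $|x|<2$ on every edge (that is, all values are $\pm1$) such that $\sum_{h(e^*)=f}x_{e^*}=\sum_{t(e^*)=f}x_{e^*}$ for every vertex $f$ of $G^*$. Then the number of facets of $\mathcal P_G$ (faces of dimension $\dim\mathcal P_G-1$) is equal to the number of nowhere-zero $2$-flows on $G^*$. -/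

import Mathlib

open scoped Graph

/-- The symmetric edge polytope of `G`: the convex hull of the vectors `e_v - e_w` in `ℝ^V`, over all
ordered pairs `(v, w)` of adjacent vertices (so both `e_v - e_w` and `e_w - e_v` occur). -/
def symmetricEdgePolytope {V : Type*} [DecidableEq V] (G : SimpleGraph V) : Set (V → ℝ) :=
  convexHull ℝ {p | ∃ v w : V, G.Adj v w ∧ p = Pi.single v 1 - Pi.single w 1}

open Classical in
/-- The dimension of a convex set: the dimension of its affine hull, and `-1` for the empty set. -/
noncomputable def polytopeDim {M : Type*} [AddCommGroup M] [Module ℝ M] (P : Set M) : ℤ :=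
  if P = ∅ then -1 else (Module.finrank ℝ (vectorSpan ℝ P) : ℤ)

/-- `F` is a face of `P`: the intersection of `P` with the zero set of an affine linear form that is
nonnegative on `P`. -/
def IsPolytopeFace {M : Type*} [AddCommGroup M] [Module ℝ M] (P F : Set M) : Prop :=
  ∃ l : M →ᵃ[ℝ] ℝ, (∀ p ∈ P, 0 ≤ l p) ∧ F = {p ∈ P | l p = 0}

/-- A facet of `P` is a face of dimension `dim P - 1`. -/
def IsPolytopeFacet {M : Type*} [AddCommGroup M] [Module ℝ M] (P F : Set M) : Prop :=
  IsPolytopeFace P F ∧ polytopeDim F = polytopeDim P - 1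

/-- A choice of a tail and a head for every edge of a multigraph: `{tail e, head e}` is the set of
ends of `e`. -/
structure GraphOrientation {α β : Type*} (D : Graph α β) where
  tail : E(D) → α
  head : E(D) → α
  isLink : ∀ e : E(D), D.IsLink e (tail e) (head e)

/-- A flow on a finite multigraph with values in an abelian group: at every vertex, the sum over the
edges that have their head there is the sum over the edges that have their tail there. -/
def GraphOrientation.IsFlow {α β A : Type*} [AddCommGroup A] {D : Graph α β} [Finite E(D)]
    (o : GraphOrientation D) (x : E(D) → A) : Prop :=
  ∀ v ∈ V(D), ∑ᶠ e ∈ {e | o.head e = v}, x e = ∑ᶠ e ∈ {e | o.tail e = v}, x e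

/-- A `k`-flow: an integer-valued flow all of whose values are smaller than `k` in absolute value. -/
def GraphOrientation.IsKFlow {α β : Type*} {D : Graph α β} [Finite E(D)]
    (o : GraphOrientation D) (k : ℤ) (x : E(D) → ℤ) : Prop :=
  o.IsFlow x ∧ ∀ e, |x e| < k

/-- No value of `x` is zero. -/
def IsNowhereZero {ι A : Type*} [Zero A] (x : ι → A) : Prop :=
  ∀ e, x e ≠ 0

/-- A combinatorial embedding (rotation system) of a simple graph in a closed oriented surface: for
each vertex `v` a cyclic order of all darts (oriented edges) that start at `v`. The permutation `next`
sends every dart to its successor in the cyclic order around its starting vertex. -/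
structure RotationSystem {V : Type*} (G : SimpleGraph V) where
  next : Equiv.Perm G.Dart
  fst_next : ∀ d, (next d).fst = d.fst
  sameCycle : ∀ d d' : G.Dart, d.fst = d'.fst → next.SameCycle d d'

namespace RotationSystem

variable {V : Type*} {G : SimpleGraph V}

/-- Reversal of darts. -/
def reverse (G : SimpleGraph V) : Equiv.Perm G.Dart :=
  SimpleGraph.Dart.symm_involutive.toPerm SimpleGraph.Dart.symm

/-- The face permutation: traverse the dart `d`, then leave its end point by the dart that follows the
reverse of `d` in the cyclic order there. -/
def facePerm (R : RotationSystem G) : Equiv.Perm G.Dart :=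
  (reverse G).trans R.next

/-- The faces of the embedding: the orbits of the face permutation. -/
def Face (R : RotationSystem G) : Type _ :=
  Quotient (Equiv.Perm.SameCycle.setoid R.facePerm)

/-- The face on one fixed side of the dart `d` (the face on the other side is that of `d.symm`). -/
def face (R : RotationSystem G) (d : G.Dart) : R.Face :=
  Quotient.mk (Equiv.Perm.SameCycle.setoid R.facePerm) d

/-- The embedding of a finite connected graph with at least one edge is planar if its surface is the
sphere, i.e. has Euler characteristic `|V| - |E| + |F| = 2`. -/
def IsPlanar (R : RotationSystem G) : Prop :=
  (Nat.card V : ℤ) - Nat.card G.edgeSet + Nat.card R.Face = 2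

/-- The geometric dual of an embedded graph: a multigraph, possibly with loops and parallel edges,
whose vertices are the faces. It has one edge for every edge `e` of `G` (we use the same label for
both), which joins the faces on the two sides of `e`. -/
def dual (R : RotationSystem G) : Graph R.Face (Sym2 V) where
  vertexSet := Set.univ
  edgeSet := G.edgeSet
  IsLink e f g := ∃ d : G.Dart, d.edge = e ∧ R.face d = f ∧ R.face d.symm = g
  isLink_symm := by
    rintro e -
    refine ⟨?_⟩
    rintro f g ⟨d, hd, hf, hg⟩
    exact ⟨d.symm, by rw [SimpleGraph.Dart.edge_symm, hd], hg, by
      rw [SimpleGraph.Dart.symm_symm, hf]⟩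
  eq_or_eq_of_isLink_of_isLink := by
    rintro e f g f' g' ⟨d, rfl, rfl, rfl⟩ ⟨d', hd', rfl, rfl⟩
    rcases (SimpleGraph.dart_edge_eq_iff d' d).1 hd' with rfl | rfl
    · exact Or.inl rfl
    · exact Or.inr (by rw [SimpleGraph.Dart.symm_symm])
  edge_mem_iff_exists_isLink := by
    intro e
    constructor
    · induction e using Sym2.ind with
      | _ v w => exact fun h => ⟨_, _, ⟨(v, w), h⟩, rfl, rfl, rfl⟩
    · rintro ⟨_, _, d, rfl, -⟩
      exact d.edge_mem
  left_mem_of_isLink := fun _ _ _ _ => Set.mem_univ _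

end RotationSystem

/-! ### Facets of the symmetric edge polytope -/

section Polytope

/-! Facets correspond to potentials on `G` modulo constants. The polytope is symmetric about 0, so a
facet misses 0 and lies on a hyperplane `⟨g, p⟩ = 1`, where `g` varies by at most 1 along edges and
the tight edges span everything (`exists_levelFace_of_isPolytopeFacet`). In a bipartite graph,
parity then makes every edge difference ±1 (`exists_levelFace_of_isBipartite`); conversely such a
`g` always gives a facet (`isPolytopeFacet_levelFace`). Edge differences of potentials are flows on
the dual, and on the sphere Euler's formula makes the two spaces equal (`exists_coboundary_eq`).
Hence facets match the ±1-valued flows. -/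

/-- The linear form `p ↦ ∑ v, g v * p v`. -/
def pairing {V : Type*} [Fintype V] (g : V → ℝ) : (V → ℝ) →ₗ[ℝ] ℝ :=
  Fintype.linearCombination ℝ g

theorem pairing_apply {V : Type*} [Fintype V] (g p : V → ℝ) : pairing g p = ∑ v, p v * g v := by
  simp [pairing, Fintype.linearCombination_apply]

variable {V : Type*} [DecidableEq V]

/-- The vectors `e_v - e_w` over the ordered pairs of adjacent vertices. -/
def edgeVectors (G : SimpleGraph V) : Set (V → ℝ) :=
  {p | ∃ v w : V, G.Adj v w ∧ p = Pi.single v 1 - Pi.single w 1}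

theorem edgeVectors_subset (G : SimpleGraph V) : edgeVectors G ⊆ symmetricEdgePolytope G :=
  subset_convexHull ℝ _

theorem symmetricEdgePolytope_subset_span (G : SimpleGraph V) :
    symmetricEdgePolytope G ⊆ Submodule.span ℝ (edgeVectors G) :=
  convexHull_min Submodule.subset_span (Submodule.convex _)

theorem zero_mem_symmetricEdgePolytope {G : SimpleGraph V} {v w : V} (h : G.Adj v w) :
    (0 : V → ℝ) ∈ symmetricEdgePolytope G := by
  have h1 := edgeVectors_subset G ⟨v, w, h, rfl⟩
  have h2 := edgeVectors_subset G ⟨w, v, h.symm, rfl⟩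
  have := (convex_convexHull ℝ (edgeVectors G)) h1 h2 (a := 1/2) (b := 1/2)
    (by norm_num) (by norm_num) (by norm_num)
  rwa [← neg_sub (Pi.single v 1 : V → ℝ), smul_neg, add_neg_cancel] at this

theorem vectorSpan_eq_span_of_zero_mem {M : Type*} [AddCommGroup M] [Module ℝ M] {P : Set M}
    (h : (0 : M) ∈ P) : vectorSpan ℝ P = Submodule.span ℝ P := by
  rw [vectorSpan_eq_span_vsub_set_right ℝ h]
  simp

theorem vectorSpan_symmetricEdgePolytope {G : SimpleGraph V} {v w : V} (h : G.Adj v w) :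
    vectorSpan ℝ (symmetricEdgePolytope G) = Submodule.span ℝ (edgeVectors G) := by
  rw [vectorSpan_eq_span_of_zero_mem (zero_mem_symmetricEdgePolytope h)]
  exact le_antisymm (Submodule.span_le.2 (symmetricEdgePolytope_subset_span G))
    (Submodule.span_mono (edgeVectors_subset G))

variable [Fintype V]

theorem pairing_single_sub (g : V → ℝ) (v w : V) :
    pairing g (Pi.single v 1 - Pi.single w 1) = g v - g w := by
  simp [pairing]

theorem pairing_le_one_of_mem {G : SimpleGraph V} {g : V → ℝ}
    (hg : ∀ v w, G.Adj v w → g v - g w ≤ 1) {p : V → ℝ} (hp : p ∈ symmetricEdgePolytope G) :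
    pairing g p ≤ 1 := by
  refine convexHull_min (t := {p | pairing g p ≤ 1}) ?_
    (convex_halfSpace_le (pairing g).isLinear 1) hp
  rintro _ ⟨v, w, h, rfl⟩
  rw [Set.mem_ofPred_eq, pairing_single_sub]
  exact hg v w h

/-- The part of the symmetric edge polytope on the hyperplane `⟨g, p⟩ = 1`. -/
def levelFace (G : SimpleGraph V) (g : V → ℝ) : Set (V → ℝ) :=
  {p ∈ symmetricEdgePolytope G | pairing g p = 1}

theorem pairing_vectorSpan_levelFace {G : SimpleGraph V} {g p : V → ℝ}
    (hp : p ∈ vectorSpan ℝ (levelFace G g)) : pairing g p = 0 := by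
  have : vectorSpan ℝ (levelFace G g) ≤ LinearMap.ker (pairing g) := by
    refine Submodule.span_le.2 ?_
    rintro _ ⟨a, ha, b, hb, rfl⟩
    simp [ha.2, hb.2]
  exact this hp

/-- Adding one point of a level face to its direction space gives its linear span. -/
theorem finrank_span_levelFace {G : SimpleGraph V} {g : V → ℝ} (hne : (levelFace G g).Nonempty) :
    Module.finrank ℝ (Submodule.span ℝ (levelFace G g)) =
      Module.finrank ℝ (vectorSpan ℝ (levelFace G g)) + 1 := by
  obtain ⟨p, hp⟩ := hne
  have hle : vectorSpan ℝ (levelFace G g) ≤ Submodule.span ℝ (levelFace G g) := by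
    refine Submodule.span_le.2 ?_
    rintro _ ⟨a, ha, b, hb, rfl⟩
    exact Submodule.sub_mem _ (Submodule.subset_span ha) (Submodule.subset_span hb)
  apply le_antisymm
  · have : Submodule.span ℝ (levelFace G g) ≤
        vectorSpan ℝ (levelFace G g) ⊔ Submodule.span ℝ {p} := by
      refine Submodule.span_le.2 fun q hq => ?_
      have h1 := vsub_mem_vectorSpan ℝ hq hp
      rw [vsub_eq_sub] at h1
      rw [← sub_add_cancel q p]
      exact Submodule.add_mem_sup h1 (Submodule.mem_span_singleton_self p)
    refine (Submodule.finrank_mono this).trans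
      ((Submodule.finrank_add_le_finrank_add_finrank _ _).trans ?_)
    exact Nat.add_le_add_left ((finrank_span_le_card {p}).trans_eq (by simp)) _
  -- The inclusion is strict because the hyperplane misses the origin: `p` pairs to 1 with `g`,
  -- directions pair to 0.
  · refine Submodule.finrank_lt_finrank_of_lt (lt_of_le_of_ne hle fun h => ?_)
    have h1 : p ∈ vectorSpan ℝ (levelFace G g) := h ▸ Submodule.subset_span hp
    have := pairing_vectorSpan_levelFace h1
    rw [hp.2] at this
    exact one_ne_zero this

theorem span_levelFace_le (G : SimpleGraph V) (g : V → ℝ) :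
    Submodule.span ℝ (levelFace G g) ≤ Submodule.span ℝ (edgeVectors G) :=
  Submodule.span_le.2 fun _ hp => symmetricEdgePolytope_subset_span G hp.1

theorem isPolytopeFace_levelFace {G : SimpleGraph V} {g : V → ℝ}
    (hg : ∀ v w, G.Adj v w → g v - g w ≤ 1) :
    IsPolytopeFace (symmetricEdgePolytope G) (levelFace G g) := by
  refine ⟨AffineMap.const ℝ _ 1 - (pairing g).toAffineMap, fun p hp => ?_, ?_⟩
  · simpa using pairing_le_one_of_mem hg hp
  · ext p
    change _ ∧ pairing g p = 1 ↔ _ ∧ 1 - pairing g p = 0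
    rw [sub_eq_zero, eq_comm (a := (1 : ℝ))]

/-- Each edge, in one of its two directions, contributes a vector to the level face, so the face has
full linear span; its affine dimension is one less. -/
theorem isPolytopeFacet_levelFace {G : SimpleGraph V} {v₀ w₀ : V} (h₀ : G.Adj v₀ w₀) {g : V → ℝ}
    (hg : ∀ v w, G.Adj v w → g v - g w = 1 ∨ g v - g w = -1) :
    IsPolytopeFacet (symmetricEdgePolytope G) (levelFace G g) := by
  have hmem : ∀ v w, G.Adj v w → g v - g w = 1 →
      (Pi.single v 1 - Pi.single w 1 : V → ℝ) ∈ levelFace G g := fun v w h h1 =>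
    ⟨edgeVectors_subset G ⟨v, w, h, rfl⟩, by rw [pairing_single_sub, h1]⟩
  have hspan : ∀ v w, G.Adj v w →
      (Pi.single v 1 - Pi.single w 1 : V → ℝ) ∈ Submodule.span ℝ (levelFace G g) := by
    intro v w h
    rcases hg v w h with h1 | h1
    · exact Submodule.subset_span (hmem v w h h1)
    · rw [← neg_sub]
      exact Submodule.neg_mem _ (Submodule.subset_span (hmem w v h.symm (by linarith)))
  have hne : (levelFace G g).Nonempty := by
    rcases hg v₀ w₀ h₀ with h1 | h1
    · exact ⟨_, hmem _ _ h₀ h1⟩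
    · exact ⟨_, hmem _ _ h₀.symm (by linarith)⟩
  refine ⟨isPolytopeFace_levelFace fun v w h => ?_, ?_⟩
  · rcases hg v w h with h1 | h1 <;> linarith
  · have heq : Submodule.span ℝ (levelFace G g) = Submodule.span ℝ (edgeVectors G) := by
      refine le_antisymm (span_levelFace_le G g) (Submodule.span_le.2 ?_)
      rintro _ ⟨v, w, h, rfl⟩
      exact hspan v w h
    have hP : symmetricEdgePolytope G ≠ ∅ :=
      Set.nonempty_iff_ne_empty.1 ⟨0, zero_mem_symmetricEdgePolytope h₀⟩
    rw [polytopeDim, polytopeDim, if_neg hne.ne_empty, if_neg hP,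
      vectorSpan_symmetricEdgePolytope h₀, ← heq, finrank_span_levelFace hne]
    push_cast
    ring

/-- A linear form that vanishes on the edge vectors with `⟨g, p⟩ = 1` vanishes on the whole level
face, if `⟨g, p⟩ ≤ 1` on all edge vectors. -/
theorem pairing_eq_zero_of_mem_levelFace {G : SimpleGraph V} {g c : V → ℝ}
    (hg : ∀ v w, G.Adj v w → g v - g w ≤ 1)
    (hc : ∀ v w, G.Adj v w → g v - g w = 1 → c v = c w) {p : V → ℝ} (hp : p ∈ levelFace G g) :
    pairing c p = 0 := by
  obtain ⟨ι, _, w, z, hw, hw1, hz, hsum⟩ := mem_convexHull_iff_exists_fintype.1 hp.1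
  -- The slacks `1 - ⟨g, z i⟩` are nonnegative with weighted sum 0, so only tight edge vectors carry
  -- weight.
  have h1 : ∑ i, w i * (1 - pairing g (z i)) = 0 := by
    have := hp.2
    rw [← hsum, map_sum] at this
    simp only [map_smul, smul_eq_mul] at this
    simp only [mul_sub, mul_one, Finset.sum_sub_distrib, this, hw1, sub_self]
  have hz1 : ∀ i, pairing g (z i) ≤ 1 := fun i =>
    pairing_le_one_of_mem hg (edgeVectors_subset G (hz i))
  rw [Finset.sum_eq_zero_iff_of_nonneg
    fun i _ => mul_nonneg (hw i) (sub_nonneg.2 (hz1 i))] at h1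
  rw [← hsum, map_sum]
  refine Finset.sum_eq_zero fun i _ => ?_
  rw [map_smul, smul_eq_mul]
  rcases mul_eq_zero.1 (h1 i (Finset.mem_univ i)) with h | h
  · rw [h, zero_mul]
  · obtain ⟨a, b, hab, hzi⟩ := hz i
    rw [hzi, pairing_single_sub] at h
    rw [hzi, pairing_single_sub, hc a b hab (by linarith), sub_self, mul_zero]

/-- Every facet of the symmetric edge polytope is a level face. -/
theorem exists_levelFace_of_isPolytopeFacet {G : SimpleGraph V} {v₀ w₀ : V} (h₀ : G.Adj v₀ w₀)
    {F : Set (V → ℝ)} (hF : IsPolytopeFacet (symmetricEdgePolytope G) F) :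
    ∃ g : V → ℝ, (∀ v w, G.Adj v w → g v - g w ≤ 1) ∧ F = levelFace G g ∧ F.Nonempty ∧
      Submodule.span ℝ F = Submodule.span ℝ (edgeVectors G) := by
  obtain ⟨⟨l, hl, hFl⟩, hdim⟩ := hF
  have h0 := zero_mem_symmetricEdgePolytope h₀
  have hP : symmetricEdgePolytope G ≠ ∅ := Set.nonempty_iff_ne_empty.1 ⟨0, h0⟩
  have hlin : ∀ p, l p = l.linear p + l 0 := fun p => by
    have := l.map_vadd 0 p
    simpa using this
  -- If `l 0 = 0`, then `l` is linear and nonnegative on a symmetric set, so it vanishes there and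
  -- `F` is the whole polytope.
  have hpos : 0 < l 0 := by
    refine lt_of_le_of_ne (hl 0 h0) fun hz => ?_
    have hzero : ∀ p ∈ Submodule.span ℝ (edgeVectors G), l.linear p = 0 := by
      intro p hp
      have : Submodule.span ℝ (edgeVectors G) ≤ LinearMap.ker l.linear := by
        refine Submodule.span_le.2 ?_
        rintro _ ⟨v, w, h, rfl⟩
        have h1 := hl _ (edgeVectors_subset G ⟨v, w, h, rfl⟩)
        have h2 := hl _ (edgeVectors_subset G ⟨w, v, h.symm, rfl⟩)
        rw [hlin, ← hz, add_zero, map_sub] at h1 h2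
        simp only [SetLike.mem_coe, LinearMap.mem_ker, map_sub]
        linarith
      exact this hp
    have hFP : F = symmetricEdgePolytope G := by
      rw [hFl]
      refine Set.Subset.antisymm (fun p hp => hp.1) fun p hp => ⟨hp, ?_⟩
      rw [hlin, hzero p (symmetricEdgePolytope_subset_span G hp), ← hz, add_zero]
    rw [hFP] at hdim
    omega
  -- Normalised so that `l p = l 0 * (1 - ⟨g, p⟩)`.
  set g : V → ℝ := fun v => -(l.linear (Pi.single v 1)) / l 0 with hgdef
  have hpair : ∀ p, pairing g p = -(l.linear p) / l 0 := by
    intro p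
    have : l.linear p = ∑ v, p v * l.linear (Pi.single v 1) := by
      conv_lhs => rw [pi_eq_sum_univ' p, map_sum]
      simp
    rw [pairing_apply, this, ← Finset.sum_neg_distrib, Finset.sum_div]
    exact Finset.sum_congr rfl fun v _ => by rw [hgdef]; ring
  have hg : ∀ v w, G.Adj v w → g v - g w ≤ 1 := by
    intro v w h
    have h1 := hl _ (edgeVectors_subset G ⟨v, w, h, rfl⟩)
    rw [hlin] at h1
    rw [← pairing_single_sub, hpair, div_le_one hpos]
    linarith
  have hFg : F = levelFace G g := by
    rw [hFl]
    ext p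
    simp only [levelFace, Set.mem_ofPred_eq, hpair, div_eq_one_iff_eq hpos.ne', hlin p]
    exact and_congr_right fun _ => ⟨fun h => by linarith, fun h => by linarith⟩
  -- Positive dimension rules out the empty face, whose dimension is -1 by convention.
  have hW : 0 < Module.finrank ℝ (Submodule.span ℝ (edgeVectors G)) := by
    rw [Module.finrank_pos_iff_exists_ne_zero]
    refine ⟨⟨_, Submodule.subset_span ⟨v₀, w₀, h₀, rfl⟩⟩, fun h => ?_⟩
    have := congrFun (congrArg Subtype.val h) v₀
    simp [h₀.ne] at this
  rw [polytopeDim, polytopeDim, if_neg hP, vectorSpan_symmetricEdgePolytope h₀] at hdim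
  have hne : F.Nonempty := by
    rw [Set.nonempty_iff_ne_empty]
    intro hE
    rw [if_pos hE] at hdim
    omega
  rw [if_neg hne.ne_empty] at hdim
  refine ⟨g, hg, hFg, hne, ?_⟩
  rw [hFg] at hne hdim ⊢
  refine Submodule.eq_of_le_of_finrank_le (span_levelFace_le G g) ?_
  rw [finrank_span_levelFace hne]
  omega

/-- For a bipartite graph the facets are the level faces of the functions whose values at adjacent
vertices differ by exactly one. -/
theorem exists_levelFace_of_isBipartite {G : SimpleGraph V} {v₀ w₀ : V} (h₀ : G.Adj v₀ w₀)
    (hbip : G.IsBipartite) {F : Set (V → ℝ)} (hF : IsPolytopeFacet (symmetricEdgePolytope G) F) :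
    ∃ g : V → ℝ, (∀ v w, G.Adj v w → g v - g w = 1 ∨ g v - g w = -1) ∧ F = levelFace G g := by
  classical
  obtain ⟨g, hg, rfl, -, hspan⟩ := exists_levelFace_of_isPolytopeFacet h₀ hF
  refine ⟨g, fun v w h => ?_, rfl⟩
  obtain ⟨col⟩ := hbip
  -- `Q` is invariant along tight edges, so its indicator `c` pairs to 0 with the face, hence with
  -- its span, which contains all edge vectors. Thus `Q` passes from `v` to `w`, and `g v - g w` is
  -- an odd integer in [-1, 1].
  let Q : V → Prop := fun u => ∃ n : ℤ, g v - g u = n ∧ (Even n ↔ col v = col u)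
  have hQ : ∀ a b, G.Adj a b → g a - g b = 1 → (Q a ↔ Q b) := by
    intro a b hab h1
    have hcol := col.valid hab
    have key : ∀ i j k : Fin 2, j ≠ k → ((i = k) ↔ ¬ (i = j)) := by decide
    constructor
    · rintro ⟨n, hn, hc⟩
      refine ⟨n + 1, by push_cast; linarith, ?_⟩
      rw [Int.even_add_one, hc, key _ _ _ hcol]
    · rintro ⟨n, hn, hc⟩
      refine ⟨n - 1, by push_cast; linarith, ?_⟩
      rw [Int.even_sub_one, hc, key _ _ _ hcol.symm]
  let c : V → ℝ := fun u => if Q u then 1 else 0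
  have hc0 : Submodule.span ℝ (edgeVectors G) ≤ LinearMap.ker (pairing c) := by
    rw [← hspan]
    refine Submodule.span_le.2 fun p hp => pairing_eq_zero_of_mem_levelFace hg ?_ hp
    intro a b hab h1
    simp only [c, hQ a b hab h1]
  have hvw : c v - c w = 0 := by
    rw [← pairing_single_sub]
    exact hc0 (Submodule.subset_span ⟨v, w, h, rfl⟩)
  have hQv : Q v := ⟨0, by simp, by simp⟩
  have hQw : Q w := by
    by_contra hcon
    simp [c, hQv, hcon] at hvw
  obtain ⟨n, hn, hpar⟩ := hQw
  have h1 := hg v w h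
  have h2 := hg w v h.symm
  have hodd : ¬ Even n := fun he => col.valid h (hpar.1 he)
  have h3 : n ≤ 1 := by exact_mod_cast hn ▸ h1
  have h4 : -1 ≤ n := by
    have : (-1 : ℝ) ≤ n := by linarith
    exact_mod_cast this
  have h5 : n ≠ 0 := by
    rintro rfl
    exact hodd (by simp)
  have h6 : n = 1 ∨ n = -1 := by omega
  rcases h6 with rfl | rfl
  · left; simpa using hn
  · right; simpa using hn

end Polytope

/-! ### Potentials on the graph and flows on its dual -/

section Flow

namespace RotationSystem

variable {V : Type*} {G : SimpleGraph V} (R : RotationSystem G)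

theorem face_facePerm (d : G.Dart) : R.face (R.facePerm d) = R.face d := by
  apply Quotient.sound
  exact Equiv.Perm.sameCycle_apply_left.2 (Equiv.Perm.SameCycle.refl _ _)

theorem facePerm_symm (d : G.Dart) : R.facePerm d.symm = R.next d := by
  change R.next d.symm.symm = _
  rw [SimpleGraph.Dart.symm_symm]

theorem fst_facePerm (d : G.Dart) : (R.facePerm d).fst = d.snd :=
  R.fst_next d.symm

variable {R}

/-- A function on the faces that takes equal values on both sides of every edge is constant. -/
theorem face_function_constant {A : Type*} (hconn : G.Connected) {y : R.Face → A}
    (hy : ∀ d : G.Dart, y (R.face d) = y (R.face d.symm)) (f f' : R.Face) : y f = y f' := by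
  -- One step of rotation about a vertex crosses a single edge: `next d` lies on the face of
  -- `d.symm`.
  have hnext : ∀ d, y (R.face (R.next d)) = y (R.face d) := fun d => by
    rw [← facePerm_symm, face_facePerm, ← hy]
  have hpow : ∀ (n : ℤ) (d : G.Dart), y (R.face ((R.next ^ n) d)) = y (R.face d) := by
    intro n
    induction n with
    | zero => simp
    | succ n ih => intro d; rw [zpow_add_one, Equiv.Perm.mul_apply, ih, hnext]
    | pred n ih =>
      intro d
      rw [zpow_sub_one, Equiv.Perm.mul_apply, ih, ← hnext (R.next⁻¹ d), ← Equiv.Perm.mul_apply,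
        mul_inv_cancel, Equiv.Perm.one_apply]
  have hfst : ∀ d d' : G.Dart, d.fst = d'.fst → y (R.face d) = y (R.face d') := by
    intro d d' h
    obtain ⟨n, rfl⟩ := R.sameCycle d d' h
    rw [hpow]
  have hwalk : ∀ {u v : V} (_ : G.Walk u v) (d d' : G.Dart), d.fst = u → d'.fst = v →
      y (R.face d) = y (R.face d') := by
    intro u v p
    induction p with
    | nil => intro d d' h h'; exact hfst d d' (h.trans h'.symm)
    | @cons a b c hab _ ih =>
      intro d d' h h'
      rw [hfst d ⟨(a, b), hab⟩ h, hy]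
      exact ih _ d' rfl h'
  obtain ⟨d, rfl⟩ := Quotient.exists_rep f
  obtain ⟨d', rfl⟩ := Quotient.exists_rep f'
  obtain ⟨p⟩ := hconn.preconnected d.fst d'.fst
  exact hwalk p d d' rfl rfl

/-- The differences of a function on the vertices sum to zero around every face. -/
theorem sum_face_sub [Fintype G.Dart] [DecidableEq R.Face] (g : V → ℝ) (f : R.Face) :
    ∑ d : G.Dart, (if R.face d = f then g d.snd - g d.fst else 0) = 0 := by
  -- The sum telescopes: `facePerm` preserves the face and starts the next dart where `d` ends.
  have h := Equiv.sum_comp R.facePerm (fun d => if R.face d = f then g d.fst else 0)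
  simp only [face_facePerm, fst_facePerm] at h
  rw [← sub_eq_zero, ← Finset.sum_sub_distrib] at h
  refine (Finset.sum_congr rfl fun d _ => ?_).trans h
  split_ifs <;> simp

end RotationSystem

namespace GraphOrientation

open RotationSystem

variable {V : Type*} {G : SimpleGraph V} {R : RotationSystem G} (o : GraphOrientation R.dual)

/-- The dart on `e` that has the tail of the dual edge on its fixed side. -/
noncomputable def dart (e : E(R.dual)) : G.Dart := (o.isLink e).choose

theorem edge_dart (e : E(R.dual)) : (o.dart e).edge = e := (o.isLink e).choose_spec.1

theorem face_dart (e : E(R.dual)) : R.face (o.dart e) = o.tail e := (o.isLink e).choose_spec.2.1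

theorem face_dart_symm (e : E(R.dual)) : R.face (o.dart e).symm = o.head e :=
  (o.isLink e).choose_spec.2.2

theorem exists_dart_eq (d : G.Dart) : ∃ e, o.dart e = d ∨ (o.dart e).symm = d := by
  refine ⟨⟨d.edge, d.edge_mem⟩, ?_⟩
  rcases (SimpleGraph.dart_edge_eq_iff _ _).1 (o.edge_dart ⟨d.edge, d.edge_mem⟩) with h | h
  · exact Or.inl h
  · exact Or.inr (by rw [h, SimpleGraph.Dart.symm_symm])

/-- Splits sums over darts into the two sides of each edge; this works for dual loops too, as a dart
differs from its reverse. -/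
theorem dart_sum_bijective :
    Function.Bijective (Sum.elim o.dart fun e => (o.dart e).symm) := by
  have hedge : ∀ e e', (o.dart e).edge = (o.dart e').edge → e = e' := fun e e' h => by
    rw [edge_dart, edge_dart] at h
    exact Subtype.ext h
  constructor
  · rintro (e | e) (e' | e') h <;> simp only [Sum.elim_inl, Sum.elim_inr] at h
    · rw [hedge e e' (by rw [h])]
    · obtain rfl := hedge e e' (by rw [h, SimpleGraph.Dart.edge_symm])
      exact absurd h.symm (SimpleGraph.Dart.symm_ne _)
    · obtain rfl := hedge e e' (by rw [← h, SimpleGraph.Dart.edge_symm])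
      exact absurd h (SimpleGraph.Dart.symm_ne _)
    · rw [hedge e e' (by rw [← SimpleGraph.Dart.edge_symm, h, SimpleGraph.Dart.edge_symm])]
  · intro d
    obtain ⟨e, h | h⟩ := o.exists_dart_eq d
    · exact ⟨Sum.inl e, h⟩
    · exact ⟨Sum.inr e, h⟩

/-- The difference of a function on the vertices along every edge. -/
noncomputable def coboundary : (V → ℝ) →ₗ[ℝ] (E(R.dual) → ℝ) where
  toFun g e := g (o.dart e).snd - g (o.dart e).fst
  map_add' g h := by ext e; simp only [Pi.add_apply]; ring
  map_smul' c g := by ext e; simp only [Pi.smul_apply, smul_eq_mul, RingHom.id_apply]; ring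

theorem coboundary_apply (g : V → ℝ) (e : E(R.dual)) :
    o.coboundary g e = g (o.dart e).snd - g (o.dart e).fst := rfl

/-- Statements about `g v - g w` for adjacent `v`, `w` follow from those about the coboundary. -/
theorem adj_of_coboundary {p : V → V → Prop} (hsymm : ∀ v w, p v w → p w v)
    (h : ∀ e, p (o.dart e).snd (o.dart e).fst) {v w : V} (hvw : G.Adj v w) : p v w := by
  obtain ⟨e, he | he⟩ := o.exists_dart_eq ⟨(v, w), hvw⟩
  · have := h e
    rw [he] at this
    exact hsymm _ _ this
  · have := h e
    rw [← SimpleGraph.Dart.symm_symm (o.dart e), he] at this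
    exact this

open Classical in
/-- The vertex-edge incidence matrix of the oriented dual. -/
noncomputable def incidence : Matrix R.Face E(R.dual) ℝ :=
  Matrix.of fun f e => (if o.tail e = f then 1 else 0) - (if o.head e = f then 1 else 0)

variable [Fintype E(R.dual)]

theorem isFlow_iff_incidence (x : E(R.dual) → ℤ) :
    o.IsFlow x ↔ o.incidence.mulVec (fun e => (x e : ℝ)) = 0 := by
  classical
  rw [IsFlow, funext_iff]
  refine forall_congr' fun f => ?_
  have hf : f ∈ V(R.dual) := Set.mem_univ f
  simp only [hf, forall_true_left]
  have h1 : ∀ t : E(R.dual) → R.Face,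
      ∑ᶠ e ∈ {e | t e = f}, x e = ∑ e, if t e = f then x e else 0 := by
    intro t
    rw [finsum_mem_eq_finite_toFinset_sum _ (Set.toFinite _), ← Finset.sum_filter]
    exact Finset.sum_congr (by ext; simp) fun _ _ => rfl
  rw [h1, h1]
  have h2 : o.incidence.mulVec (fun e => (x e : ℝ)) f =
      ((∑ e, (if o.tail e = f then x e else 0) -
        ∑ e, (if o.head e = f then x e else 0) : ℤ) : ℝ) := by
    simp only [Matrix.mulVec, dotProduct, incidence, Matrix.of_apply, sub_mul, ite_mul, one_mul,
      zero_mul, Finset.sum_sub_distrib]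
    push_cast
    rfl
  rw [h2, Pi.zero_apply, Int.cast_eq_zero, sub_eq_zero, eq_comm]

variable [Fintype V]

/-- The two darts of an edge carry opposite differences, so conservation at a face is the
telescoping sum around it. Planarity plays no role here. -/
theorem incidence_mulVec_coboundary (g : V → ℝ) :
    o.incidence.mulVec (o.coboundary g) = 0 := by
  classical
  ext f
  have : Fintype G.Dart := Fintype.ofFinite _
  rw [Pi.zero_apply, ← sum_face_sub g f, ← (Equiv.ofBijective _ o.dart_sum_bijective).sum_comp,
    Fintype.sum_sum_type]
  simp only [Equiv.ofBijective_apply, Sum.elim_inl, Sum.elim_inr, face_dart, face_dart_symm,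
    Matrix.mulVec, dotProduct, incidence, Matrix.of_apply, coboundary_apply,
    ← Finset.sum_add_distrib]
  refine Finset.sum_congr rfl fun e _ => ?_
  change _ = _ + (if o.head e = f then g (o.dart e).fst - g (o.dart e).snd else 0)
  split_ifs <;> ring

theorem finrank_ker_le_one {ι M : Type*} [AddCommGroup M] [Module ℝ M] [Finite ι]
    (A : (ι → ℝ) →ₗ[ℝ] M) (hA : ∀ g, A g = 0 → ∀ i j, g i = g j) :
    Module.finrank ℝ (LinearMap.ker A) ≤ 1 := by
  rcases isEmpty_or_nonempty ι with _ | ⟨⟨i⟩⟩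
  · rw [Module.finrank_zero_of_subsingleton]
    exact zero_le_one
  · have : LinearMap.ker A ≤ Submodule.span ℝ {fun _ => 1} := fun g hg =>
      Submodule.mem_span_singleton.2 ⟨g i, by ext j; simp [hA g hg i j]⟩
    exact (Submodule.finrank_mono this).trans ((finrank_span_le_card _).trans_eq (by simp))

/-- In the planar case every real flow on the dual is a coboundary. -/
theorem exists_coboundary_eq (hconn : G.Connected) (hplanar : R.IsPlanar) {x : E(R.dual) → ℝ}
    (hx : o.incidence.mulVec x = 0) : ∃ g, o.coboundary g = x := by
  classical
  have : Finite R.Face := Quotient.finite _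
  have : Fintype R.Face := Fintype.ofFinite _
  have hle : LinearMap.range o.coboundary ≤ LinearMap.ker o.incidence.mulVecLin := by
    rintro _ ⟨g, rfl⟩
    exact o.incidence_mulVec_coboundary g
  have hA : Module.finrank ℝ (LinearMap.ker o.coboundary) ≤ 1 := by
    refine finrank_ker_le_one _ fun g hg => ?_
    have hadj : ∀ v w, G.Adj v w → g v = g w := fun v w =>
      o.adj_of_coboundary (p := fun v w => g v = g w) (fun _ _ h => h.symm)
        fun e => sub_eq_zero.1 (congrFun hg e)
    intro v w
    obtain ⟨p⟩ := hconn.preconnected v w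
    induction p with
    | nil => rfl
    | cons h _ ih => exact (hadj _ _ h).trans ih
  have hB : Module.finrank ℝ (LinearMap.ker o.incidence.transpose.mulVecLin) ≤ 1 := by
    refine finrank_ker_le_one _ fun y hy => face_function_constant hconn fun d => ?_
    have hedge : ∀ e, y (o.tail e) = y (o.head e) := by
      intro e
      have := congrFun hy e
      simpa only [Matrix.mulVecLin_apply, Matrix.mulVec, dotProduct, incidence,
        Matrix.transpose_apply, Matrix.of_apply, sub_mul, ite_mul, one_mul, zero_mul,
        Finset.sum_sub_distrib, Finset.sum_ite_eq, Finset.mem_univ, if_true, Pi.zero_apply,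
        sub_eq_zero] using this
    obtain ⟨e, rfl | rfl⟩ := o.exists_dart_eq d
    · rw [face_dart, face_dart_symm, hedge]
    · rw [SimpleGraph.Dart.symm_symm, face_dart, face_dart_symm, hedge]
  have hA' := o.coboundary.finrank_range_add_finrank_ker
  have hB' := o.incidence.transpose.mulVecLin.finrank_range_add_finrank_ker
  have hB'' := o.incidence.mulVecLin.finrank_range_add_finrank_ker
  have hr := o.incidence.rank_transpose
  rw [Matrix.rank, Matrix.rank] at hr
  rw [Module.finrank_fintype_fun_eq_card] at hA' hB' hB''
  have hE : Nat.card G.edgeSet = Fintype.card E(R.dual) := Nat.card_eq_fintype_card (α := E(R.dual))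
  rw [IsPlanar, hE, Nat.card_eq_fintype_card, Nat.card_eq_fintype_card] at hplanar
  -- The range has dimension at least |V| - 1 by `hA`; by `hB` the flow space has dimension at most
  -- |E| - |F| + 1, which is |V| - 1 by Euler.
  have heq := Submodule.eq_of_le_of_finrank_le hle (by omega)
  have hmem : x ∈ LinearMap.range o.coboundary := by
    rw [heq]
    exact hx
  exact hmem

end GraphOrientation

end Flow

/-! ### The bijection between flows and facets -/

theorem mainTheorem10 {V : Type*} [Fintype V] [DecidableEq V] [Nontrivial V]
    (G : SimpleGraph V) (hconn : G.Connected) (hbip : G.IsBipartite)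
    (R : RotationSystem G) (hplanar : R.IsPlanar) (o : GraphOrientation R.dual) :
    {F : Set (V → ℝ) | IsPolytopeFacet (symmetricEdgePolytope G) F}.encard =
      {x : E(R.dual) → ℤ | o.IsKFlow 2 x ∧ IsNowhereZero x}.encard := by
  classical
  have : Fintype E(R.dual) := Fintype.ofFinite _
  obtain ⟨v₀⟩ := hconn.nonempty
  obtain ⟨w₀, h₀⟩ := hconn.preconnected.exists_adj_of_nontrivial v₀
  have hval : ∀ {x : E(R.dual) → ℤ}, o.IsKFlow 2 x ∧ IsNowhereZero x →
      ∀ e, x e = 1 ∨ x e = -1 := by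
    rintro x ⟨⟨-, hx⟩, h0⟩ e
    have h1 := abs_lt.1 (hx e)
    have h2 := h0 e
    omega
  have hex : ∀ x : {x : E(R.dual) → ℤ | o.IsKFlow 2 x ∧ IsNowhereZero x},
      ∃ g, o.coboundary g = fun e => (x.1 e : ℝ) := fun x =>
    o.exists_coboundary_eq hconn hplanar ((o.isFlow_iff_incidence _).1 x.2.1.1)
  choose pot hpot using hex
  have hdiff : ∀ x v w, G.Adj v w → pot x v - pot x w = 1 ∨ pot x v - pot x w = -1 := by
    intro x v w
    refine o.adj_of_coboundary (p := fun v w => pot x v - pot x w = 1 ∨ pot x v - pot x w = -1)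
      (fun a b h => ?_) fun e => ?_
    · rcases h with h | h
      · right; linarith
      · left; linarith
    · have := congrFun (hpot x) e
      rw [GraphOrientation.coboundary_apply] at this
      rw [this]
      rcases hval x.2 e with h | h <;> simp [h]
  -- The facet determines the flow: an edge has value 1 exactly when its vector lies on the facet,
  -- and otherwise -1.
  have hmem : ∀ x e, (Pi.single (o.dart e).snd 1 - Pi.single (o.dart e).fst 1 : V → ℝ) ∈
      levelFace G (pot x) ↔ x.1 e = 1 := by
    intro x e
    have h1 : (Pi.single (o.dart e).snd 1 - Pi.single (o.dart e).fst 1 : V → ℝ) ∈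
        symmetricEdgePolytope G := edgeVectors_subset G ⟨_, _, (o.dart e).adj.symm, rfl⟩
    have h2 := congrFun (hpot x) e
    rw [GraphOrientation.coboundary_apply] at h2
    rw [levelFace, Set.mem_ofPred_eq, pairing_single_sub, h2, and_iff_right h1, Int.cast_eq_one]
  symm
  refine Set.encard_congr (Equiv.ofBijective
    (fun x => ⟨levelFace G (pot x), isPolytopeFacet_levelFace h₀ (hdiff x)⟩) ⟨?_, ?_⟩)
  · intro x y hxy
    have hF : levelFace G (pot x) = levelFace G (pot y) := congrArg Subtype.val hxy
    apply Subtype.ext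
    funext e
    have h := hmem x e
    rw [hF, hmem y e] at h
    have h1 := hval x.2 e
    have h2 := hval y.2 e
    omega
  · rintro ⟨F, hF⟩
    obtain ⟨g, hg, rfl⟩ := exists_levelFace_of_isBipartite h₀ hbip hF
    have hint : ∀ e, ∃ n : ℤ, (n = 1 ∨ n = -1) ∧ (n : ℝ) = o.coboundary g e := by
      intro e
      rcases hg _ _ (o.dart e).adj.symm with h | h
      · exact ⟨1, Or.inl rfl, by rw [GraphOrientation.coboundary_apply, h]; simp⟩
      · exact ⟨-1, Or.inr rfl, by rw [GraphOrientation.coboundary_apply, h]; simp⟩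
    choose x hx1 hxg using hint
    have hflow : o.IsFlow x := by
      rw [o.isFlow_iff_incidence, funext hxg]
      exact o.incidence_mulVec_coboundary g
    refine ⟨⟨x, ⟨hflow, fun e => ?_⟩, fun e => ?_⟩, Subtype.ext ?_⟩
    · rcases hx1 e with h | h <;> simp [h]
    · rcases hx1 e with h | h <;> simp [h]
    · generalize hX : (⟨x, _⟩ : {x : E(R.dual) → ℤ | o.IsKFlow 2 x ∧ IsNowhereZero x}) = X
      have hXx : X.1 = x := by rw [← hX]
      -- The chosen potential need not be `g`, but equal edge differences give equal pairings on the
      -- polytope, hence the same face.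
      have hadj : ∀ v w, G.Adj v w → pot X v - pot X w = g v - g w := by
        intro v w
        refine o.adj_of_coboundary (p := fun v w => pot X v - pot X w = g v - g w)
          (fun a b h => by linarith) fun e => ?_
        have h1 := congrFun (hpot X) e
        rw [hXx, hxg] at h1
        exact h1
      have hker : Submodule.span ℝ (edgeVectors G) ≤
          LinearMap.eqLocus (pairing (pot X)) (pairing g) := by
        refine Submodule.span_le.2 ?_
        rintro _ ⟨v, w, h, rfl⟩
        rw [SetLike.mem_coe, LinearMap.mem_eqLocus, pairing_single_sub, pairing_single_sub,
          hadj v w h]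
      ext p
      refine and_congr_right fun hp => ?_
      rw [show pairing (pot X) p = pairing g p from
        hker (symmetricEdgePolytope_subset_span G hp)]
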